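/- Let $d\ge 2$. Let $\mathcal V$ be the real vector space of Hermitian matrices on $\mathbb C^d\otimes\mathbb C^d$ with inner product $\langle X,Y\rangle=\operatorname{Tr}XY$. A positive cone is a closed convex cone $\mathcal K\subset\mathcal V$ with non-empty interior and $\mathcal K\cap(-\mathcal K)=\{0\}$; its dual is $\mathcal K^*=\{x\in\mathcal V: \langle x,y\rangle\ge 0\ \forall y\in\mathcal K\}$. Let $\mathrm{SEP}$ be the cone of all finite sums $\sum_k a_k\otimes b_k$ with $a_k,b_k$ positive semidefinite matrices on $\mathbb C^d$, and let $\mathrm{SES}$ (the standard entanglement structure) be the cone of all positive semidefinite matrices on $\mathbb C^d\otimes\mathbb C^d$. An entanglement structure is a positive cone $\mathcal K\subset\mathcal V$ with $\mathrm{SEP}\subset\mathcal K\subset\mathrm{SEP}^*$ such that the identity matrix $I$ is an inner point of $\mathcal K^*$; its state space is $\mathcal S(\mathcal K)=\{\rho\in\mathcal K:\operatorname{Tr}\rho=1\}$. Let $\mathrm{ME}$ be the set of maximally entangled states $|\psi\rangle\langle\psi|$, $|\psi\rangle=\frac1{\sqrt d}\sum_{k=1}^d|a_k\rangle\otimes|b_k\rangle$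 with orthonormal bases $(a_k)$, $(b_k)$ of $\mathbb C^d$. For $\varepsilon>0$, an $\varepsilon$-pseudo standard entanglement structure ($\varepsilon$-PSES) is an entanglement structure $\mathcal K$ that is self-dual, $\mathcal K^*=\mathcal K$, and satisfies $$D(\mathcal K):=\max_{\sigma\in\mathrm{ME}}\ \min_{\rho\in\mathcal S(\mathcal K)}\|\rho-\sigma\|_1\le\varepsilon ,$$ where $\|\cdot\|_1$ is the trace norm. A family $\mathcal K_1,\dots,\mathcal K_n$ is $n$-independent if for no $i$ does $\mathcal K_i\subset\sum_{j\ne i}\mathcal K_j$ hold. Theorem. For every $\varepsilon>0$ there are infinitely many $\varepsilon$-PSESs different from $\mathrm{SES}$. Moreover, for every natural number $n$ there is an $n$-independent family $\mathcal K_1,\dots,\mathcal K_n$ of $\varepsilon$-PSESs, all of them different from $\mathrm{SES}$. -/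

import Mathlib

open scoped Pointwise Kronecker ENNReal ComplexOrder

noncomputable section

namespace EntanglementStructure

/-- `𝒯(ℂ^ι)`: the real vector space of Hermitian matrices on the Hilbert space `ℂ^ι`. -/
abbrev Herm (ι : Type) [Fintype ι] [DecidableEq ι] : Type :=
  selfAdjoint (Matrix ι ι ℂ)

section General

variable {ι : Type} [Fintype ι] [DecidableEq ι]

/-- The inner product `⟨X, Y⟩ = Tr (X Y)`, a real number for Hermitian `X`, `Y`. -/
def hsInner (X Y : Herm ι) : ℝ :=
  ((X : Matrix ι ι ℂ) * (Y : Matrix ι ι ℂ)).trace.re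

/-- The trace norm of a Hermitian matrix: the sum of the absolute values of its eigenvalues,
counted with multiplicity. -/
def traceNorm (X : Herm ι) : ℝ :=
  ∑ i, |Matrix.IsHermitian.eigenvalues (A := (X : Matrix ι ι ℂ)) X.2 i|

/-- A positive cone: a closed convex cone with an inner point and with `K ∩ (-K) = {0}`. -/
structure IsPositiveCone (K : Set (Herm ι)) : Prop where
  isClosed : IsClosed K
  convex : Convex ℝ K
  smul_mem : ∀ c : ℝ, 0 ≤ c → ∀ x ∈ K, c • x ∈ K
  interior_nonempty : (interior K).Nonempty
  inter_neg : K ∩ -K = {0}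

/-- The dual cone `K* = {x | ⟨x, y⟩ ≥ 0 for all y ∈ K}`. -/
def dual (K : Set (Herm ι)) : Set (Herm ι) :=
  {x | ∀ y ∈ K, 0 ≤ hsInner x y}

/-- The cone `𝒯₊(ℂ^ι)` of positive semidefinite matrices. -/
def psd (ι : Type) [Fintype ι] [DecidableEq ι] : Set (Herm ι) :=
  {X | (X : Matrix ι ι ℂ).PosSemidef}

/-- The state space of the model with cone `K` and unit `u`. -/
def stateSpace (K : Set (Herm ι)) (u : Herm ι) : Set (Herm ι) :=
  {ρ | ρ ∈ K ∧ hsInner ρ u = 1}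

/-- The tensor product of two cones: all finite sums `∑ₖ aₖ ⊗ bₖ` with `aₖ ∈ K`, `bₖ ∈ L`. -/
def tensorCone {κ : Type} [Fintype κ] [DecidableEq κ] (K : Set (Herm ι)) (L : Set (Herm κ)) :
    Set (Herm (ι × κ)) :=
  {X | ∃ (N : ℕ) (a : Fin N → Herm ι) (b : Fin N → Herm κ),
    (∀ k, a k ∈ K) ∧ (∀ k, b k ∈ L) ∧
    (X : Matrix (ι × κ) (ι × κ) ℂ) =
      ∑ k, (a k : Matrix ι ι ℂ) ⊗ₖ (b k : Matrix κ κ ℂ)}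

/-- `D(K‖σ)`: the distance in trace norm from `σ` to the state space of `K` (with unit `I`). -/
def distToState (K : Set (Herm ι)) (σ : Herm ι) : ℝ≥0∞ :=
  ⨅ ρ ∈ stateSpace K 1, ENNReal.ofReal (traceNorm (ρ - σ))

/-- Independence of a finite family of sets: no `K i` lies in the sum of the others. -/
def IsIndependentFamily {n : ℕ} (K : Fin n → Set (Herm ι)) : Prop :=
  ∀ i, ¬ K i ⊆ ∑ j ∈ Finset.univ.erase i, K j

end General

/-- `SEP`: the separable cone on `ℂ^d ⊗ ℂ^d`. -/
def SEP (d : ℕ) : Set (Herm (Fin d × Fin d)) :=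
  tensorCone (psd (Fin d)) (psd (Fin d))

/-- `SES`: the standard entanglement structure on `ℂ^d ⊗ ℂ^d`. -/
def SES (d : ℕ) : Set (Herm (Fin d × Fin d)) :=
  psd (Fin d × Fin d)

/-- The vector `d^(-1/2) ∑ₖ aₖ ⊗ bₖ` built from orthonormal bases `a`, `b` of `ℂ^d`. -/
def maxEntVec {d : ℕ} (a b : OrthonormalBasis (Fin d) ℂ (EuclideanSpace ℂ (Fin d))) :
    Fin d × Fin d → ℂ :=
  fun p => ((Real.sqrt d : ℝ) : ℂ)⁻¹ * ∑ k, a k p.1 * b k p.2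

/-- `ME`: the maximally entangled states `|ψ⟩⟨ψ|` on `ℂ^d ⊗ ℂ^d`. -/
def ME (d : ℕ) : Set (Herm (Fin d × Fin d)) :=
  {σ | ∃ a b : OrthonormalBasis (Fin d) ℂ (EuclideanSpace ℂ (Fin d)),
    (σ : Matrix (Fin d × Fin d) (Fin d × Fin d) ℂ) =
      Matrix.vecMulVec (maxEntVec a b) (star (maxEntVec a b))}

/-- `D(K)`: the largest distance of a maximally entangled state from the state space of `K`. -/
def maxEntDist {d : ℕ} (K : Set (Herm (Fin d × Fin d))) : ℝ≥0∞ :=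
  ⨆ σ ∈ ME d, distToState K σ

/-- An entanglement structure on `ℂ^d ⊗ ℂ^d`: a positive cone `K` whose dual has the unit `I` as an
inner point, with `SEP ⊆ K ⊆ SEP*`. -/
structure IsEntanglementStructure {d : ℕ} (K : Set (Herm (Fin d × Fin d))) : Prop where
  isPositiveCone : IsPositiveCone K
  unit_mem_interior_dual : (1 : Herm (Fin d × Fin d)) ∈ interior (dual K)
  sep_subset : SEP d ⊆ K
  subset_dual_sep : K ⊆ dual (SEP d)

/-- An `ε`-pseudo standard entanglement structure: a self-dual entanglement structure with
`D(K) ≤ ε`. -/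
structure IsPSES {d : ℕ} (ε : ℝ) (K : Set (Herm (Fin d × Fin d))) : Prop where
  isEntanglementStructure : IsEntanglementStructure K
  selfDual : dual K = K
  undistinguishable : maxEntDist K ≤ ENNReal.ofReal ε

end EntanglementStructure

end

/-!
Call a set `L` of Hermitian matrices dual-positive if `L ⊆ dual L`. A maximal dual-positive set is
self-dual, because a point `w` of its dual can be adjoined (`⟨w, w⟩ ≥ 0`); so by Zorn's lemma every
dual-positive set lies in a self-dual cone. If the set contains `SEP`, the cone is an entanglement
structure, since `I` is already an inner point of `SEP`.

For a maximally entangled `φ` and `1 < t`, the witness `1 - t φ` is negative on `φ`, hence not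
positive semidefinite, but it is non-negative on `SEP` because `φ` overlaps a product state by at
most `1 / d`. For `t` close to `1` it is also non-negative on all maximally entangled states
depolarized by a small `δ`, and on any finitely many maximally entangled states `≠ φ`.
Adjoining it to `SEP` together with these states gives a self-dual cone whose distance from `ME` is
at most `d δ`.

Doing this for distinct `φ₁, …, φₙ` with `φⱼ ∈ Kᵢ` for `j ≠ i`, self-duality makes `φᵢ` non-negative
on every `Kⱼ` with `j ≠ i`, while it is negative on the witness in `Kᵢ`: the `Kᵢ` are independent.
The members of an independent family of cones are distinct, so families of every size force
infinitely many cones.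
-/

namespace EntanglementStructure

section General

open Module in
theorem mem_interior_of_span_eq_top {E : Type*} [AddCommGroup E] [Module ℝ E]
    [FiniteDimensional ℝ E] [TopologicalSpace E] [IsTopologicalAddGroup E] [ContinuousSMul ℝ E]
    [T2Space E] {C : PointedCone ℝ E} (hspan : Submodule.span ℝ (C : Set E) = ⊤) {u : E}
    (hu : u ∈ C) (hC : ∀ x ∈ C, ∃ c : ℝ, c • u - x ∈ C) : u ∈ interior (C : Set E) := by
  let e := Basis.ofSpan hspan.ge
  have := FiniteDimensional.fintypeBasisIndex e
  have he (i) : e i ∈ C := Basis.ofSpan_subset hspan.ge ⟨i, rfl⟩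
  choose c hc using fun i => hC (e i) (he i)
  let f (x : E) : ℝ := ∑ i, |e.repr (x - u) i| * c i
  have hf : Continuous f := by
    have hcoord (i) : Continuous fun x => e.repr (x - u) i :=
      (e.coord i).continuous_of_finiteDimensional.comp (continuous_id.sub continuous_const)
    fun_prop
  refine mem_interior.2 ⟨{x | f x < 1}, fun x hx => ?_, isOpen_lt hf continuous_const, by simp [f]⟩
  have hterm (i) : (|e.repr (x - u) i| * c i) • u + e.repr (x - u) i • e i ∈ C := by
    rcases le_total 0 (e.repr (x - u) i) with h | h
    · rw [abs_of_nonneg h, mul_smul, ← smul_add]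
      have : c i • u + e i = (c i • u - e i) + (2 : ℝ) • e i := by module
      exact C.smul_mem h (this ▸ add_mem (hc i) (C.smul_mem zero_le_two (he i)))
    · rw [abs_of_nonpos h, show (-e.repr (x - u) i * c i) • u + e.repr (x - u) i • e i =
        (-e.repr (x - u) i) • (c i • u - e i) by module]
      exact C.smul_mem (neg_nonneg.2 h) (hc i)
  have hx' : x = (1 - f x) • u +
      ∑ i, ((|e.repr (x - u) i| * c i) • u + e.repr (x - u) i • e i) := by
    rw [Finset.sum_add_distrib, e.sum_repr, ← Finset.sum_smul]
    module
  rw [hx']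
  exact add_mem (C.smul_mem (sub_nonneg.2 hx.le) hu) (sum_mem fun i _ => hterm i)

open scoped ComplexStarModule in
theorem span_real_eq_top_of_span_complex_eq_top {A : Type*} [AddCommGroup A] [Module ℂ A]
    [StarAddMonoid A] [StarModule ℂ A] {s : Set (selfAdjoint A)}
    (hs : Submodule.span ℂ ((↑) '' s : Set A) = ⊤) : Submodule.span ℝ s = ⊤ := by
  have hparts (a : A) : ℜ a ∈ Submodule.span ℝ s ∧ ℑ a ∈ Submodule.span ℝ s := by
    have ha : a ∈ Submodule.span ℂ ((↑) '' s : Set A) := hs ▸ Submodule.mem_top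
    induction ha using Submodule.span_induction with
    | mem _ hx =>
      obtain ⟨x, hx, rfl⟩ := hx
      simpa using Submodule.subset_span hx
    | zero => simp
    | add x y _ _ hx hy =>
      simpa only [map_add] using ⟨add_mem hx.1 hy.1, add_mem hx.2 hy.2⟩
    | smul z x _ hx =>
      rw [realPart_smul, imaginaryPart_smul]
      exact ⟨sub_mem (Submodule.smul_mem _ _ hx.1) (Submodule.smul_mem _ _ hx.2),
        add_mem (Submodule.smul_mem _ _ hx.2) (Submodule.smul_mem _ _ hx.1)⟩
  refine eq_top_iff.2 fun x _ => ?_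
  simpa using (hparts x).1

theorem exists_gt_one_forall_mul_le_one {ι : Type*} [Finite ι] {f : ι → ℝ} (hf : ∀ i, f i < 1)
    {b : ℝ} (hb : 1 < b) : ∃ t, 1 < t ∧ t ≤ b ∧ ∀ i, t * f i ≤ 1 := by
  have hf' : ∀ᶠ t in nhds (1 : ℝ), ∀ i, t * f i ≤ 1 := Filter.eventually_all.2 fun i =>
    (continuous_mul_const (f i)).continuousAt.eventually_le_const (by simpa using hf i)
  have hevent : ∀ᶠ t in nhdsWithin (1 : ℝ) (Set.Ioi 1), 1 < t ∧ t ≤ b ∧ ∀ i, t * f i ≤ 1 :=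
    eventually_mem_nhdsWithin.and
      (((eventually_le_nhds hb).and hf').filter_mono nhdsWithin_le_nhds)
  exact hevent.exists

theorem exists_orthonormalBasis_circle_smul {ι E : Type*} [Fintype ι] [NormedAddCommGroup E]
    [InnerProductSpace ℂ E] (e : OrthonormalBasis ι ℂ E) (z : ι → Circle) :
    ∃ b : OrthonormalBasis ι ℂ E, ∀ i, b i = (z i : ℂ) • e i := by
  let b := e.toBasis.isUnitSMul fun i => (Circle.coe_ne_zero (z i)).isUnit
  have hb (i) : b i = (z i : ℂ) • e i := by simp [b, Module.Basis.isUnitSMul_apply]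
  have hon : Orthonormal ℂ b := by
    refine ⟨fun i => by simp [hb, norm_smul, Circle.norm_coe], fun i j hij => ?_⟩
    simp only [hb, inner_smul_left, inner_smul_right, e.orthonormal.2 hij, mul_zero]
  exact ⟨b.toOrthonormalBasis hon, fun i => by simp [hb]⟩

theorem infinite_circle : Infinite Circle :=
  have : Nontrivial Circle := ⟨1, Circle.exp Real.pi, by norm_num [Circle.ext_iff]⟩
  PreconnectedSpace.infinite

end General

section Matrix

open Matrix

theorem span_image2_kronecker_eq_top {R ι κ : Type*} [CommSemiring R] [Finite ι] [Finite κ]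
    {s : Set (Matrix ι ι R)} {t : Set (Matrix κ κ R)} (hs : Submodule.span R s = ⊤)
    (ht : Submodule.span R t = ⊤) :
    Submodule.span R (Set.image2 (· ⊗ₖ ·) s t) = ⊤ := by
  classical
  cases nonempty_fintype ι
  cases nonempty_fintype κ
  refine eq_top_iff.2 fun X _ => ?_
  rw [show Set.image2 (· ⊗ₖ ·) s t = Set.image2 (kroneckerBilinear (R := R) · ·) s t from rfl,
    ← Submodule.map₂_span_span, hs, ht, matrix_eq_sum_single X]
  refine sum_mem fun p _ => sum_mem fun q _ => ?_
  have hsingle : single p q (X p q) = single p.1 q.1 (X p q) ⊗ₖ single p.2 q.2 1 := by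
    rw [single_kronecker_single, mul_one]
  rw [hsingle]
  exact Submodule.apply_mem_map₂ _ Submodule.mem_top Submodule.mem_top

open scoped MatrixOrder Matrix.Norms.L2Operator in
theorem span_posSemidef_eq_top {ι : Type*} [Finite ι] :
    Submodule.span ℂ {A : Matrix ι ι ℂ | A.PosSemidef} = ⊤ := by
  classical
  cases nonempty_fintype ι
  simpa only [nonneg_iff_posSemidef] using CStarAlgebra.span_nonneg (A := Matrix ι ι ℂ)

variable {ι : Type*} [Fintype ι]

open scoped MatrixOrder Matrix.Norms.L2Operator in
theorem trace_mul_nonneg {A B : Matrix ι ι ℂ} (hA : A.PosSemidef) (hB : B.PosSemidef) :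
    0 ≤ (A * B).trace := by
  classical
  obtain ⟨C, rfl⟩ := CStarAlgebra.nonneg_iff_eq_star_mul_self.mp hA.nonneg
  rw [star_eq_conjTranspose, mul_assoc, trace_mul_comm]
  exact (hB.mul_mul_conjTranspose_same C).trace_nonneg

open scoped MatrixOrder Matrix.Norms.L2Operator in
theorem posSemidef_trace_smul_one_sub [DecidableEq ι] {A : Matrix ι ι ℂ} (hA : A.PosSemidef) :
    (A.trace • (1 : Matrix ι ι ℂ) - A).PosSemidef := by
  have hle : A ≤ algebraMap ℝ _ (∑ i, hA.1.eigenvalues i) := by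
    refine le_algebraMap_of_spectrum_le (fun x hx => ?_) hA.1
    rw [hA.1.spectrum_real_eq_range_eigenvalues] at hx
    obtain ⟨i, rfl⟩ := hx
    exact Finset.single_le_sum (fun j _ => hA.eigenvalues_nonneg j) (Finset.mem_univ i)
  have hscalar (r : ℝ) : algebraMap ℝ (Matrix ι ι ℂ) r = (r : ℂ) • 1 := by
    rw [Algebra.algebraMap_eq_smul_one, Complex.coe_smul]
  rw [hscalar, le_iff, Complex.ofReal_sum] at hle
  exact hA.1.trace_eq_sum_eigenvalues ▸ hle

theorem trace_mul_le {A B : Matrix ι ι ℂ} (hA : A.PosSemidef) (hB : B.PosSemidef) :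
    (A * B).trace ≤ A.trace * B.trace := by
  classical
  simpa [sub_mul] using trace_mul_nonneg (posSemidef_trace_smul_one_sub hA) hB

theorem trace_mul_self_eq_sum_eigenvalues_sq [DecidableEq ι] {A : Matrix ι ι ℂ}
    (hA : A.IsHermitian) : (A * A).trace = ∑ i, (hA.eigenvalues i : ℂ) ^ 2 := by
  nth_rw 1 2 [hA.spectral_theorem]
  rw [← map_mul, Unitary.conjStarAlgAut_apply, trace_mul_cycle, Unitary.coe_star_mul_self, one_mul,
    diagonal_mul_diagonal, trace_diagonal]
  simp [sq]

end Matrix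

section DualCone

variable {ι : Type} [Fintype ι] [DecidableEq ι]

theorem hsInner_comm (X Y : Herm ι) : hsInner X Y = hsInner Y X := by
  rw [hsInner, hsInner, Matrix.trace_mul_comm]

theorem hsInner_add_left (X Y Z : Herm ι) : hsInner (X + Y) Z = hsInner X Z + hsInner Y Z := by
  simp [hsInner, add_mul]

theorem hsInner_smul_left (c : ℝ) (X Y : Herm ι) : hsInner (c • X) Y = c * hsInner X Y := by
  simp [hsInner]

theorem hsInner_add_right (X Y Z : Herm ι) : hsInner X (Y + Z) = hsInner X Y + hsInner X Z := by
  simp [hsInner, mul_add]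

theorem hsInner_smul_right (c : ℝ) (X Y : Herm ι) : hsInner X (c • Y) = c * hsInner X Y := by
  simp [hsInner]

theorem hsInner_sub_left (X Y Z : Herm ι) : hsInner (X - Y) Z = hsInner X Z - hsInner Y Z := by
  simp [hsInner, sub_mul]

theorem hsInner_sub_right (X Y Z : Herm ι) : hsInner X (Y - Z) = hsInner X Y - hsInner X Z := by
  simp [hsInner, mul_sub]

theorem hsInner_one_one : hsInner (1 : Herm ι) 1 = Fintype.card ι := by
  simp [hsInner]

theorem continuous_hsInner_left (Y : Herm ι) : Continuous fun X : Herm ι => hsInner X Y := by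
  unfold hsInner
  fun_prop

theorem hsInner_self_eq_sum_sq (X : Herm ι) :
    hsInner X X = ∑ i, (Matrix.IsHermitian.eigenvalues (A := (X : Matrix ι ι ℂ)) X.2 i) ^ 2 := by
  rw [hsInner, trace_mul_self_eq_sum_eigenvalues_sq X.2]
  norm_cast

theorem hsInner_self_nonneg (X : Herm ι) : 0 ≤ hsInner X X := by
  rw [hsInner_self_eq_sum_sq]
  positivity

theorem hsInner_self_eq_zero {X : Herm ι} : hsInner X X = 0 ↔ X = 0 := by
  refine ⟨fun h => ?_, fun h => by simp [h, hsInner]⟩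
  rw [hsInner_self_eq_sum_sq, Finset.sum_eq_zero_iff_of_nonneg fun i _ => sq_nonneg _] at h
  refine Subtype.ext ((Matrix.IsHermitian.eigenvalues_eq_zero_iff X.2).1 (funext fun i => ?_))
  simpa using h i (Finset.mem_univ i)

theorem hsInner_nonneg_of_mem_psd {X Y : Herm ι} (hX : X ∈ psd ι) (hY : Y ∈ psd ι) :
    0 ≤ hsInner X Y :=
  (Complex.le_def.1 (trace_mul_nonneg hX hY)).1

theorem traceNorm_le_sqrt (X : Herm ι) : traceNorm X ≤ √(Fintype.card ι * hsInner X X) := by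
  refine Real.le_sqrt_of_sq_le ?_
  simpa [traceNorm, hsInner_self_eq_sum_sq] using sq_sum_le_card_mul_sum_sq (s := Finset.univ)
    (f := fun i => |Matrix.IsHermitian.eigenvalues (A := (X : Matrix ι ι ℂ)) X.2 i|)

/-- `hsInner` as a bilinear form, through which the library's dual cones apply to `dual`. -/
noncomputable def hsForm (ι : Type) [Fintype ι] [DecidableEq ι] :
    LinearMap.BilinForm ℝ (Herm ι) :=
  LinearMap.mk₂ ℝ hsInner hsInner_add_left hsInner_smul_left hsInner_add_right hsInner_smul_right

theorem hsForm_apply (X Y : Herm ι) : hsForm ι X Y = hsInner X Y := rfl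

theorem coe_dual_hsForm (K : Set (Herm ι)) :
    (PointedCone.dual (hsForm ι) K : Set (Herm ι)) = dual K := by
  ext X
  simp [dual, hsForm_apply, hsInner_comm X]

theorem zero_mem_dual (K : Set (Herm ι)) : 0 ∈ dual K :=
  coe_dual_hsForm K ▸ zero_mem (PointedCone.dual (hsForm ι) K)

theorem dual_anti {K L : Set (Herm ι)} (h : K ⊆ L) : dual L ⊆ dual K := fun _ hx y hy =>
  hx y (h hy)

theorem isClosed_dual (K : Set (Herm ι)) : IsClosed (dual K) := by
  rw [show dual K = ⋂ y ∈ K, {x | 0 ≤ hsInner x y} by ext; simp [dual]]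
  exact isClosed_biInter fun y _ => isClosed_le continuous_const (continuous_hsInner_left y)

theorem isPositiveCone_of_dual_eq {K : Set (Herm ι)} (hK : dual K = K)
    (hint : (interior K).Nonempty) : IsPositiveCone K where
  isClosed := hK ▸ isClosed_dual K
  convex := by
    rw [← hK, ← coe_dual_hsForm]
    exact PointedCone.convex _
  smul_mem := by
    rw [← hK, ← coe_dual_hsForm]
    exact fun c hc x hx => (PointedCone.dual (hsForm ι) K).smul_mem hc hx
  interior_nonempty := hint
  inter_neg := by
    have hzero : (0 : Herm ι) ∈ K := hK ▸ zero_mem_dual K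
    refine Set.Subset.antisymm (fun x ⟨hx, hx'⟩ => ?_) (by simpa using hzero)
    have hneg : 0 ≤ hsInner x (-x) := (hK.symm ▸ hx : x ∈ dual K) _ hx'
    rw [← neg_one_smul ℝ, hsInner_smul_right] at hneg
    exact hsInner_self_eq_zero.1 (by linarith [hsInner_self_nonneg x])

theorem insert_subset_dual_insert {L : Set (Herm ι)} (hL : L ⊆ dual L) {w : Herm ι}
    (hw : w ∈ dual L) : insert w L ⊆ dual (insert w L) := by
  rintro x (rfl | hx) y (rfl | hy)
  · exact hsInner_self_nonneg _
  · exact hw y hy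
  · exact hsInner_comm x _ ▸ hw x hx
  · exact hL hx y hy

theorem exists_dual_eq_self_superset {L : Set (Herm ι)} (hL : L ⊆ dual L) :
    ∃ K, L ⊆ K ∧ dual K = K := by
  have hchain : ∀ c ⊆ {K : Set (Herm ι) | K ⊆ dual K}, IsChain (· ⊆ ·) c →
      ⋃₀ c ⊆ dual (⋃₀ c) := by
    rintro c hc hchain x ⟨s, hs, hx⟩ y ⟨t, ht, hy⟩
    rcases hchain.total hs ht with h | h
    · exact hc ht (h hx) y hy
    · exact hc hs hx y (h hy)
  obtain ⟨K, hLK, hK⟩ := zorn_subset_nonempty {K : Set (Herm ι) | K ⊆ dual K}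
    (fun c hc hc' _ => ⟨⋃₀ c, hchain c hc hc', fun _ => Set.subset_sUnion_of_mem⟩) L hL
  refine ⟨K, hLK, Set.Subset.antisymm (fun w hw => ?_) hK.prop⟩
  exact hK.le_of_ge (insert_subset_dual_insert hK.prop hw) (Set.subset_insert _ _)
    (Set.mem_insert _ _)

end DualCone

section Independence

variable {ι : Type} [Fintype ι] [DecidableEq ι]

theorem mem_dual_finsetSum {α : Type*} {s : Finset α} {K : α → Set (Herm ι)} {w : Herm ι}
    (hw : ∀ j ∈ s, w ∈ dual (K j)) : w ∈ dual (∑ j ∈ s, K j) := by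
  intro x hx
  obtain ⟨g, hg, rfl⟩ := (Set.mem_finsetSum _ _ _).1 hx
  rw [← hsForm_apply, map_sum]
  exact Finset.sum_nonneg fun j hj => hw j hj _ (hg hj)

theorem isIndependentFamily_of_separating {n : ℕ} {K : Fin n → Set (Herm ι)} {w m : Fin n → Herm ι}
    (hm : ∀ i, m i ∈ K i) (hw : ∀ i j, j ≠ i → w i ∈ dual (K j))
    (hneg : ∀ i, hsInner (w i) (m i) < 0) : IsIndependentFamily K := fun i h =>
  (hneg i).not_ge
    (mem_dual_finsetSum (fun j hj => hw i j (Finset.ne_of_mem_erase hj)) _ (h (hm i)))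

theorem IsIndependentFamily.injective {n : ℕ} {K : Fin n → Set (Herm ι)}
    (h : IsIndependentFamily K) (h0 : ∀ i, 0 ∈ K i) : Function.Injective K := by
  intro i j hij
  by_contra hne
  refine h i fun x hx => (Set.mem_finsetSum _ _ _).2 ⟨Pi.single j x, fun {k} _ => ?_, ?_⟩
  · obtain rfl | hk := eq_or_ne k j
    · simpa using hij ▸ hx
    · simpa [hk] using h0 k
  · rw [Finset.sum_pi_single', if_pos (Finset.mem_erase.2 ⟨Ne.symm hne, Finset.mem_univ _⟩)]

theorem infinite_of_forall_exists_isIndependentFamily {𝒦 : Set (Set (Herm ι))}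
    (h0 : ∀ K ∈ 𝒦, 0 ∈ K)
    (h : ∀ n, ∃ K : Fin n → Set (Herm ι), (∀ i, K i ∈ 𝒦) ∧ IsIndependentFamily K) :
    𝒦.Infinite := by
  intro hfin
  have := hfin.to_subtype
  obtain ⟨K, hK, hind⟩ := h (Nat.card 𝒦 + 1)
  have hinj : Function.Injective fun i => (⟨K i, hK i⟩ : 𝒦) := fun i j hij =>
    hind.injective (fun i => h0 _ (hK i)) (congrArg Subtype.val hij)
  simpa using Nat.card_le_card_of_injective _ hinj

end Independence

section Tensor

open Matrix

variable {ι κ : Type} [Fintype ι] [DecidableEq ι] [Fintype κ] [DecidableEq κ]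

/-- The tensor product of two Hermitian matrices, as a Hermitian matrix. -/
def hermKron (a : Herm ι) (b : Herm κ) : Herm (ι × κ) :=
  ⟨(a : Matrix ι ι ℂ) ⊗ₖ (b : Matrix κ κ ℂ), by
    rw [selfAdjoint.mem_iff, star_eq_conjTranspose, conjTranspose_kronecker]
    exact congrArg₂ _ a.2 b.2⟩

theorem coe_hermKron (a : Herm ι) (b : Herm κ) :
    (hermKron a b : Matrix (ι × κ) (ι × κ) ℂ) = (a : Matrix ι ι ℂ) ⊗ₖ (b : Matrix κ κ ℂ) :=
  rfl

theorem mem_tensorCone_iff {K : Set (Herm ι)} {L : Set (Herm κ)} {X : Herm (ι × κ)} :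
    X ∈ tensorCone K L ↔ ∃ (N : ℕ) (a : Fin N → Herm ι) (b : Fin N → Herm κ),
      (∀ k, a k ∈ K) ∧ (∀ k, b k ∈ L) ∧ X = ∑ k, hermKron (a k) (b k) := by
  simp only [tensorCone, Set.mem_ofPred_eq, ← SetLike.coe_eq_coe, AddSubgroup.val_finsetSum,
    coe_hermKron]

theorem coe_hull_image2_hermKron {K : Set (Herm ι)} (L : Set (Herm κ))
    (hK : ∀ c : ℝ, 0 ≤ c → ∀ x ∈ K, c • x ∈ K) :
    (PointedCone.hull ℝ (Set.image2 hermKron K L) : Set (Herm (ι × κ))) = tensorCone K L := by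
  ext X
  rw [mem_tensorCone_iff, SetLike.mem_coe]
  constructor
  · intro hX
    obtain ⟨N, c, g, rfl⟩ := Submodule.mem_span_set'.1 hX
    choose a ha b hb hab using fun k => (g k).2
    refine ⟨N, fun k => c k • a k, b, fun k => hK _ (c k).2 _ (ha k), hb, ?_⟩
    refine Finset.sum_congr rfl fun k _ => Subtype.ext ?_
    rw [← hab, coe_hermKron]
    exact (smul_kronecker (c k : ℝ) _ _).symm
  · rintro ⟨N, a, b, ha, hb, rfl⟩
    exact sum_mem fun k _ => PointedCone.subset_hull (Set.mem_image2_of_mem (ha k) (hb k))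

theorem hermKron_mem_tensorCone {K : Set (Herm ι)} {L : Set (Herm κ)} {a : Herm ι} {b : Herm κ}
    (ha : a ∈ K) (hb : b ∈ L) : hermKron a b ∈ tensorCone K L :=
  mem_tensorCone_iff.2 ⟨1, fun _ => a, fun _ => b, fun _ => ha, fun _ => hb, by simp⟩

theorem mem_dual_tensorCone {K : Set (Herm ι)} {L : Set (Herm κ)} {X : Herm (ι × κ)}
    (h : ∀ a ∈ K, ∀ b ∈ L, 0 ≤ hsInner X (hermKron a b)) : X ∈ dual (tensorCone K L) := by
  intro Y hY
  obtain ⟨N, a, b, ha, hb, rfl⟩ := mem_tensorCone_iff.1 hY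
  rw [← hsForm_apply, map_sum]
  exact Finset.sum_nonneg fun k _ => h _ (ha k) _ (hb k)

theorem smul_mem_psd (c : ℝ) (hc : 0 ≤ c) (X : Herm ι) (hX : X ∈ psd ι) : c • X ∈ psd ι :=
  PosSemidef.smul hX hc

theorem one_mem_psd : (1 : Herm ι) ∈ psd ι :=
  PosSemidef.one

theorem hsInner_one_smul_one_sub_mem_psd {X : Herm ι} (hX : X ∈ psd ι) :
    hsInner 1 X • 1 - X ∈ psd ι := by
  have h := posSemidef_trace_smul_one_sub hX
  have htr : ((hsInner 1 X : ℝ) : ℂ) = (X : Matrix ι ι ℂ).trace := 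
    Complex.ext (by simp [hsInner]) (Complex.le_def.1 (PosSemidef.trace_nonneg hX)).2
  rwa [← htr, Complex.coe_smul] at h

theorem tensorCone_psd_subset_psd : tensorCone (psd ι) (psd κ) ⊆ psd (ι × κ) := by
  rintro _ ⟨N, a, b, ha, hb, hX⟩
  exact (congrArg PosSemidef hX).mpr (posSemidef_sum _ fun k _ => (ha k).kronecker (hb k))

theorem span_image2_hermKron_psd_eq_top :
    Submodule.span ℝ (Set.image2 hermKron (psd ι) (psd κ)) = ⊤ := by
  have himage (ι : Type) [Fintype ι] [DecidableEq ι] :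
      ((↑) '' psd ι : Set (Matrix ι ι ℂ)) = {A | A.PosSemidef} := by
    ext A
    exact ⟨fun ⟨_, hX, h⟩ => h ▸ hX, fun hA => ⟨⟨A, hA.1⟩, hA, rfl⟩⟩
  apply span_real_eq_top_of_span_complex_eq_top
  rw [Set.image_image2, ← span_image2_kronecker_eq_top (ι := ι) (κ := κ) span_posSemidef_eq_top
    span_posSemidef_eq_top, ← himage ι, ← himage κ, Set.image2_image_left, Set.image2_image_right]
  rfl

theorem smul_one_sub_hermKron_mem_hull {a : Herm ι} {b : Herm κ} (ha : a ∈ psd ι)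
    (hb : b ∈ psd κ) :
    (hsInner 1 a * hsInner 1 b) • (1 : Herm (ι × κ)) - hermKron a b ∈
      PointedCone.hull ℝ (Set.image2 hermKron (psd ι) (psd κ)) := by
  have hsplit : (hsInner 1 a * hsInner 1 b) • (1 : Herm (ι × κ)) - hermKron a b =
      hermKron (hsInner 1 a • 1 - a) (hsInner 1 b • 1) + hermKron a (hsInner 1 b • 1 - b) := by
    have hleft (A B : Matrix ι ι ℂ) (C : Matrix κ κ ℂ) : (A - B) ⊗ₖ C = A ⊗ₖ C - B ⊗ₖ C := by
      ext
      simp [sub_mul]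
    have hright (A : Matrix ι ι ℂ) (B C : Matrix κ κ ℂ) : A ⊗ₖ (B - C) = A ⊗ₖ B - A ⊗ₖ C := by
      ext
      simp [mul_sub]
    ext1
    simp [coe_hermKron, hleft, hright, smul_kronecker, kronecker_smul, mul_smul,
      smul_comm (hsInner 1 a)]
  rw [hsplit]
  have hmem {x : Herm ι} {y : Herm κ} (hx : x ∈ psd ι) (hy : y ∈ psd κ) :=
    PointedCone.subset_hull (R := ℝ) (Set.mem_image2_of_mem (f := hermKron) hx hy)
  refine add_mem (hmem (hsInner_one_smul_one_sub_mem_psd ha) (smul_mem_psd _ ?_ _ one_mem_psd))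
    (hmem ha (hsInner_one_smul_one_sub_mem_psd hb))
  exact hsInner_nonneg_of_mem_psd one_mem_psd hb

theorem one_mem_interior_tensorCone_psd :
    (1 : Herm (ι × κ)) ∈ interior (tensorCone (psd ι) (psd κ)) := by
  rw [← coe_hull_image2_hermKron _ smul_mem_psd]
  have : FiniteDimensional ℝ (Herm (ι × κ)) :=
    inferInstanceAs (FiniteDimensional ℝ (selfAdjoint.submodule ℝ (Matrix (ι × κ) (ι × κ) ℂ)))
  have : ContinuousSMul ℝ (Herm (ι × κ)) :=
    ⟨(continuous_fst.smul (continuous_subtype_val.comp continuous_snd)).subtype_mk _⟩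
  refine mem_interior_of_span_eq_top ?_ ?_ fun x hx => ?_
  · exact top_unique (span_image2_hermKron_psd_eq_top.ge.trans
      (Submodule.span_mono PointedCone.subset_hull))
  · refine PointedCone.subset_hull ⟨1, one_mem_psd, 1, one_mem_psd, ?_⟩
    ext1
    simp [coe_hermKron]
  · induction hx using Submodule.span_induction with
    | mem _ hx =>
      obtain ⟨a, ha, b, hb, rfl⟩ := hx
      exact ⟨_, smul_one_sub_hermKron_mem_hull ha hb⟩
    | zero => exact ⟨0, by simp⟩
    | add x y _ _ hx hy =>
      obtain ⟨⟨r, hr⟩, s, hs⟩ := hx, hy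
      exact ⟨r + s, by simpa [add_smul, add_sub_add_comm] using add_mem hr hs⟩
    | smul c x _ hx =>
      obtain ⟨r, hr⟩ := hx
      exact ⟨c * r, by simpa [smul_sub, mul_smul] using Submodule.smul_mem _ c hr⟩

theorem isEntanglementStructure_of_dual_eq {d : ℕ} {K : Set (Herm (Fin d × Fin d))}
    (hK : dual K = K) (hsep : SEP d ⊆ K) : IsEntanglementStructure K := by
  have hint : (1 : Herm (Fin d × Fin d)) ∈ interior K :=
    interior_mono hsep one_mem_interior_tensorCone_psd
  exact
    { isPositiveCone := isPositiveCone_of_dual_eq hK ⟨1, hint⟩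
      unit_mem_interior_dual := hK.symm ▸ hint
      sep_subset := hsep
      subset_dual_sep := hK ▸ dual_anti hsep }

end Tensor

section PureState

open Matrix

variable {ι κ : Type} [Fintype ι] [DecidableEq ι] [Fintype κ] [DecidableEq κ]

/-- The Hermitian matrix `|v⟩⟨v|`. -/
def rankOne (v : ι → ℂ) : Herm ι :=
  ⟨vecMulVec v (star v), (posSemidef_vecMulVec_self_star v).1⟩

theorem hsInner_rankOne (v : ι → ℂ) (X : Herm ι) :
    hsInner (rankOne v) X = (star v ⬝ᵥ (X : Matrix ι ι ℂ) *ᵥ v).re := by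
  rw [hsInner, rankOne, vecMulVec_mul, trace_vecMulVec, dotProduct_mulVec, dotProduct_comm]

/-- Pure states `|ψ⟩⟨ψ|` with `‖ψ‖ = 1`, encoded by positivity, unit trace and unit purity. -/
structure IsPureState (σ : Herm ι) : Prop where
  mem_psd : σ ∈ psd ι
  hsInner_one : hsInner σ 1 = 1
  hsInner_self : hsInner σ σ = 1

theorem isPureState_rankOne {v : ι → ℂ} (hv : star v ⬝ᵥ v = 1) : IsPureState (rankOne v) where
  mem_psd := posSemidef_vecMulVec_self_star v
  hsInner_one := by simp [hsInner_rankOne, hv]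
  hsInner_self := by
    rw [hsInner_rankOne]
    simp [rankOne, vecMulVec_mulVec, hv]

theorem IsPureState.hsInner_lt_one {σ τ : Herm ι} (hσ : IsPureState σ) (hτ : IsPureState τ)
    (hne : σ ≠ τ) : hsInner σ τ < 1 := by
  have hpos : 0 < hsInner (σ - τ) (σ - τ) :=
    (hsInner_self_nonneg _).lt_of_ne' (hsInner_self_eq_zero.not.2 (sub_ne_zero.2 hne))
  rw [hsInner_sub_left, hsInner_sub_right, hsInner_sub_right, hσ.hsInner_self, hτ.hsInner_self,
    hsInner_comm τ σ] at hpos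
  linarith

theorem IsPureState.hsInner_le_one {σ τ : Herm ι} (hσ : IsPureState σ) (hτ : IsPureState τ) :
    hsInner σ τ ≤ 1 := by
  obtain rfl | hne := eq_or_ne σ τ
  · exact hσ.hsInner_self.le
  · exact (hσ.hsInner_lt_one hτ hne).le

theorem star_vec_dotProduct_hermKron_mulVec_vec (a : Herm ι) (b : Herm κ) (V : Matrix κ ι ℂ) :
    star (vec V) ⬝ᵥ (hermKron a b : Matrix (ι × κ) (ι × κ) ℂ) *ᵥ vec V =
      (a.1ᵀ * (Vᴴ * b.1 * V)).trace := by
  rw [coe_hermKron, kronecker_mulVec_vec, star_vec_dotProduct_vec, trace_mul_comm a.1ᵀ,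
    Matrix.mul_assoc, Matrix.mul_assoc, Matrix.mul_assoc]

end PureState

section MaximallyEntangled

open Matrix

variable {d : ℕ}

theorem exists_maxEntVec_eq_smul_vec
    (a b : OrthonormalBasis (Fin d) ℂ (EuclideanSpace ℂ (Fin d))) :
    ∃ V ∈ unitaryGroup (Fin d) ℂ, maxEntVec a b = ((√d : ℝ) : ℂ)⁻¹ • vec V := by
  let e := EuclideanSpace.basisFun (Fin d) ℂ
  refine ⟨e.toBasis.toMatrix b * (e.toBasis.toMatrix a)ᵀ, mul_mem ?_ ?_, ?_⟩
  · exact e.toMatrix_orthonormalBasis_mem_unitary b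
  · exact transpose_mem_unitaryGroup_iff.2 (e.toMatrix_orthonormalBasis_mem_unitary a)
  · ext p
    simp [maxEntVec, e, vec, mul_apply, Module.Basis.toMatrix_apply, mul_comm]

theorem inv_sqrt_mul_star_inv_sqrt (d : ℕ) :
    star ((√d : ℝ) : ℂ)⁻¹ * ((√d : ℝ) : ℂ)⁻¹ = ((d : ℝ)⁻¹ : ℝ) := by
  rw [star_inv₀, Complex.star_def, Complex.conj_ofReal, ← mul_inv, ← Complex.ofReal_mul,
    Real.mul_self_sqrt d.cast_nonneg, Complex.ofReal_inv]

theorem exists_eq_rankOne_of_mem_ME {σ : Herm (Fin d × Fin d)} (hσ : σ ∈ ME d) :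
    ∃ V ∈ unitaryGroup (Fin d) ℂ, σ = rankOne (((√d : ℝ) : ℂ)⁻¹ • vec V) := by
  obtain ⟨a, b, h⟩ := hσ
  obtain ⟨V, hV, hab⟩ := exists_maxEntVec_eq_smul_vec a b
  exact ⟨V, hV, hab ▸ Subtype.ext h⟩

theorem isPureState_of_mem_ME (hd : d ≠ 0) {σ : Herm (Fin d × Fin d)} (hσ : σ ∈ ME d) :
    IsPureState σ := by
  obtain ⟨V, hV, rfl⟩ := exists_eq_rankOne_of_mem_ME hσ
  refine isPureState_rankOne ?_
  rw [star_smul, smul_dotProduct, dotProduct_smul, star_vec_dotProduct_vec, smul_smul,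
    inv_sqrt_mul_star_inv_sqrt, ← star_eq_conjTranspose, mem_unitaryGroup_iff'.1 hV]
  simp [hd]

theorem hsInner_hermKron_le_of_mem_ME {σ : Herm (Fin d × Fin d)} (hσ : σ ∈ ME d)
    {a b : Herm (Fin d)} (ha : a ∈ psd (Fin d)) (hb : b ∈ psd (Fin d)) :
    hsInner σ (hermKron a b) ≤ (d : ℝ)⁻¹ * hsInner 1 (hermKron a b) := by
  obtain ⟨V, hV, rfl⟩ := exists_eq_rankOne_of_mem_ME hσ
  have hunit : V * Vᴴ = 1 := mem_unitaryGroup_iff.1 hV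
  have hle := trace_mul_le (PosSemidef.transpose ha)
    (PosSemidef.conjTranspose_mul_mul_same hb V)
  rw [trace_mul_cycle, hunit, one_mul, trace_transpose, ← trace_kronecker] at hle
  rw [hsInner_rankOne, star_smul, mulVec_smul, smul_dotProduct, dotProduct_smul, smul_smul,
    inv_sqrt_mul_star_inv_sqrt, star_vec_dotProduct_hermKron_mulVec_vec, smul_eq_mul,
    Complex.re_ofReal_mul]
  refine mul_le_mul_of_nonneg_left ?_ (by positivity)
  simpa [hsInner, coe_hermKron] using (Complex.le_def.1 hle).1

theorem ME_infinite (hd : 2 ≤ d) : (ME d).Infinite := by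
  let i₀ : Fin d := ⟨0, by omega⟩
  let i₁ : Fin d := ⟨1, by omega⟩
  have h01 : i₁ ≠ i₀ := by simp [i₀, i₁]
  let e := EuclideanSpace.basisFun (Fin d) ℂ
  choose a ha using fun z : Circle =>
    exists_orthonormalBasis_circle_smul e (Pi.mulSingle i₀ z)
  have hvec (z i) : maxEntVec (a z) e (i, i) =
      ((√d : ℝ) : ℂ)⁻¹ * (Pi.mulSingle i₀ z : Fin d → Circle) i := by
    simp [maxEntVec, ha, e]
  have hentry (z) : (rankOne (maxEntVec (a z) e)).1 (i₀, i₀) (i₁, i₁) =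
      ((d : ℝ)⁻¹ : ℝ) * (z : ℂ) := by
    rw [← inv_sqrt_mul_star_inv_sqrt]
    simp [rankOne, vecMulVec_apply, hvec, h01, mul_comm, mul_left_comm]
  have := infinite_circle
  refine Set.infinite_of_injective_forall_mem (f := fun z => rankOne (maxEntVec (a z) e))
    (fun z w hzw => Circle.ext ?_) fun z => ⟨a z, e, rfl⟩
  have hmul : ((d : ℝ)⁻¹ : ℝ) * (z : ℂ) = ((d : ℝ)⁻¹ : ℝ) * (w : ℂ) := by
    rw [← hentry, ← hentry]
    exact congrArg (fun X => X.1 (i₀, i₀) (i₁, i₁)) hzw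
  exact mul_left_cancel₀ (by norm_cast; positivity) hmul

end MaximallyEntangled

section Depolarization

variable {ι : Type} [Fintype ι] [DecidableEq ι] {δ t : ℝ} {σ φ ρ : Herm ι}

/-- The state `σ` mixed with the maximally mixed state, which gets the weight `δ`. -/
noncomputable def depolarize (δ : ℝ) (σ : Herm ι) : Herm ι :=
  (1 - δ) • σ + (δ / Fintype.card ι) • 1

theorem hsInner_depolarize (hφ : hsInner φ 1 = 1) :
    hsInner φ (depolarize δ σ) = (1 - δ) * hsInner φ σ + δ / Fintype.card ι := by
  rw [depolarize, hsInner_add_right, hsInner_smul_right, hsInner_smul_right, hφ, mul_one]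

theorem depolarize_mem_psd (h0 : 0 ≤ δ) (h1 : δ ≤ 1) (hσ : σ ∈ psd ι) : depolarize δ σ ∈ psd ι :=
  Matrix.PosSemidef.add (smul_mem_psd _ (sub_nonneg.2 h1) _ hσ)
    (smul_mem_psd _ (by positivity) _ one_mem_psd)

theorem IsPureState.nonempty (hσ : IsPureState σ) : Nonempty ι := by
  by_contra h
  rw [not_nonempty_iff] at h
  simpa [hsInner] using hσ.hsInner_one

theorem IsPureState.hsInner_depolarize_one (hσ : IsPureState σ) :
    hsInner (depolarize δ σ) 1 = 1 := by
  have := hσ.nonempty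
  rw [depolarize, hsInner_add_left, hsInner_smul_left, hsInner_smul_left, hσ.hsInner_one,
    hsInner_one_one]
  field_simp
  ring

theorem IsPureState.traceNorm_depolarize_sub_le (hσ : IsPureState σ) (h0 : 0 ≤ δ) :
    traceNorm (depolarize δ σ - σ) ≤ √(Fintype.card ι) * δ := by
  have := hσ.nonempty
  have hdiff : depolarize δ σ - σ = δ • ((Fintype.card ι : ℝ)⁻¹ • 1 - σ) := by
    rw [depolarize, div_eq_mul_inv]
    module
  have hnorm : hsInner (depolarize δ σ - σ) (depolarize δ σ - σ) =
      δ ^ 2 * (1 - (Fintype.card ι : ℝ)⁻¹) := by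
    rw [hdiff]
    simp only [hsInner_smul_left, hsInner_smul_right, hsInner_sub_left, hsInner_sub_right,
      hsInner_one_one, hsInner_comm 1 σ, hσ.hsInner_one, hσ.hsInner_self]
    field_simp
    ring
  calc traceNorm (depolarize δ σ - σ)
      ≤ √(Fintype.card ι * hsInner (depolarize δ σ - σ) (depolarize δ σ - σ)) :=
        traceNorm_le_sqrt _
    _ ≤ √(Fintype.card ι * δ ^ 2) := by
        rw [hnorm]
        gcongr
        exact mul_le_of_le_one_right (sq_nonneg δ) (sub_le_self _ (by positivity))
    _ = √(Fintype.card ι) * δ := by rw [Real.sqrt_mul (by positivity), Real.sqrt_sq h0]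

theorem IsPureState.hsInner_depolarize_le [Nontrivial ι] (hφ : IsPureState φ) (hσ : IsPureState σ)
    (h0 : 0 ≤ δ) (h1 : δ ≤ 1) : hsInner φ (depolarize δ σ) ≤ 1 - δ / 2 := by
  have hcard : (2 : ℝ) ≤ Fintype.card ι := by exact_mod_cast Fintype.one_lt_card (α := ι)
  calc hsInner φ (depolarize δ σ) = (1 - δ) * hsInner φ σ + δ / Fintype.card ι :=
        hsInner_depolarize hφ.hsInner_one
    _ ≤ (1 - δ) * 1 + δ / 2 := by
        have := sub_nonneg.2 h1
        gcongr
        exact hφ.hsInner_le_one hσ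
    _ = 1 - δ / 2 := by ring

/-- An entanglement witness: for `1 < t` it is negative on the pure state `φ`. -/
noncomputable def witness (t : ℝ) (φ : Herm ι) : Herm ι := 1 - t • φ

theorem hsInner_witness (hρ : hsInner ρ 1 = 1) :
    hsInner (witness t φ) ρ = 1 - t * hsInner φ ρ := by
  rw [witness, hsInner_sub_left, hsInner_smul_left, hsInner_comm 1 ρ, hρ]

theorem IsPureState.hsInner_witness_neg (hφ : IsPureState φ) (ht : 1 < t) :
    hsInner φ (witness t φ) < 0 := by
  rw [hsInner_comm, hsInner_witness hφ.hsInner_one, hφ.hsInner_self]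
  linarith

theorem hsInner_witness_depolarize_nonneg [Nontrivial ι] (hφ : IsPureState φ) (hσ : IsPureState σ)
    (h0 : 0 ≤ δ) (h1 : δ ≤ 1) (ht0 : 0 ≤ t) (ht : t ≤ 1 + δ / 2) :
    0 ≤ hsInner (witness t φ) (depolarize δ σ) := by
  rw [hsInner_witness hσ.hsInner_depolarize_one, sub_nonneg]
  calc t * hsInner φ (depolarize δ σ) ≤ t * (1 - δ / 2) :=
        mul_le_mul_of_nonneg_left (hφ.hsInner_depolarize_le hσ h0 h1) ht0
    _ ≤ (1 + δ / 2) * (1 - δ / 2) := mul_le_mul_of_nonneg_right ht (by linarith)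
    _ ≤ 1 := by linarith [sq_nonneg δ]

end Depolarization

section Construction

variable {d : ℕ} {t δ : ℝ} {φ : Herm (Fin d × Fin d)}

theorem witness_mem_dual_SEP (hφ : φ ∈ ME d) (ht0 : 0 ≤ t) (htd : t ≤ d) :
    witness t φ ∈ dual (SEP d) := by
  refine mem_dual_tensorCone fun a ha b hb => ?_
  have hpos : 0 ≤ hsInner 1 (hermKron a b) := hsInner_nonneg_of_mem_psd one_mem_psd
    (tensorCone_psd_subset_psd (hermKron_mem_tensorCone ha hb))
  rw [witness, hsInner_sub_left, hsInner_smul_left, sub_nonneg]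
  calc t * hsInner φ (hermKron a b) ≤ t * ((d : ℝ)⁻¹ * hsInner 1 (hermKron a b)) :=
        mul_le_mul_of_nonneg_left (hsInner_hermKron_le_of_mem_ME hφ ha hb) ht0
    _ = t / d * hsInner 1 (hermKron a b) := by ring
    _ ≤ hsInner 1 (hermKron a b) :=
        mul_le_of_le_one_left hpos (div_le_one_of_le₀ htd d.cast_nonneg)

theorem maxEntDist_le_of_depolarize_mem (hd : d ≠ 0) (h0 : 0 ≤ δ)
    {K : Set (Herm (Fin d × Fin d))} (hK : depolarize δ '' ME d ⊆ K) :
    maxEntDist K ≤ ENNReal.ofReal (d * δ) := by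
  refine iSup₂_le fun σ hσ => ?_
  have hpure := isPureState_of_mem_ME hd hσ
  refine iInf₂_le_of_le (depolarize δ σ)
    ⟨hK (Set.mem_image_of_mem _ hσ), hpure.hsInner_depolarize_one⟩ (ENNReal.ofReal_le_ofReal ?_)
  simpa using hpure.traceNorm_depolarize_sub_le h0

theorem exists_isPSES_witness_mem (hd : 2 ≤ d) (h0 : 0 ≤ δ) (h1 : δ ≤ 1) (hφ : φ ∈ ME d)
    (ht0 : 0 ≤ t) (ht : t ≤ 1 + δ / 2) {S : Set (Herm (Fin d × Fin d))} (hS : S ⊆ ME d)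
    (hφS : ∀ σ ∈ S, t * hsInner φ σ ≤ 1) : ∃ K, IsPSES (d * δ) K ∧ witness t φ ∈ K ∧ S ⊆ K := by
  have hd0 : d ≠ 0 := by omega
  have : Nontrivial (Fin d) := Fin.nontrivial_iff_two_le.2 hd
  have hd2 : (2 : ℝ) ≤ d := by exact_mod_cast hd
  have hpure {σ} (hσ : σ ∈ ME d) : IsPureState σ := isPureState_of_mem_ME hd0 hσ
  let L := SEP d ∪ depolarize δ '' ME d ∪ S
  have hLpsd : L ⊆ psd _ := by
    rintro _ ((hx | ⟨σ, hσ, rfl⟩) | hx)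
    · exact tensorCone_psd_subset_psd hx
    · exact depolarize_mem_psd h0 h1 (hpure hσ).mem_psd
    · exact (hpure (hS hx)).mem_psd
  have hwL : witness t φ ∈ dual L := by
    rintro x ((hx | ⟨σ, hσ, rfl⟩) | hx)
    · exact witness_mem_dual_SEP hφ ht0 (by linarith) x hx
    · exact hsInner_witness_depolarize_nonneg (hpure hφ) (hpure hσ) h0 h1 ht0 ht
    · rw [hsInner_witness (hpure (hS hx)).hsInner_one]
      exact sub_nonneg.2 (hφS x hx)
  have hLL : L ⊆ dual L := fun x hx y hy => hsInner_nonneg_of_mem_psd (hLpsd hx) (hLpsd hy)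
  obtain ⟨K, hLK, hK⟩ := exists_dual_eq_self_superset (insert_subset_dual_insert hLL hwL)
  obtain ⟨hw, ⟨hsep, hdep⟩, hSK⟩ : witness t φ ∈ K ∧ (SEP d ⊆ K ∧ depolarize δ '' ME d ⊆ K) ∧
      S ⊆ K := by simpa only [L, Set.insert_subset_iff, Set.union_subset_iff] using hLK
  exact ⟨K, ⟨isEntanglementStructure_of_dual_eq hK hsep, hK,
    maxEntDist_le_of_depolarize_mem hd0 h0 hdep⟩, hw, hSK⟩

theorem IsPSES.mono {ε ε' : ℝ} (hε : ε ≤ ε') {K : Set (Herm (Fin d × Fin d))} (hK : IsPSES ε K) :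
    IsPSES ε' K :=
  { hK with undistinguishable := hK.undistinguishable.trans (ENNReal.ofReal_le_ofReal hε) }

theorem exists_isIndependentFamily_isPSES (hd : 2 ≤ d) {ε : ℝ} (hε : 0 < ε) (n : ℕ) :
    ∃ K : Fin n → Set (Herm (Fin d × Fin d)),
      (∀ i, IsPSES ε (K i) ∧ K i ≠ SES d) ∧ IsIndependentFamily K := by
  have hd0 : 0 < d := by omega
  let e := (ME_infinite hd).natEmbedding
  let φ (i : Fin n) : Herm (Fin d × Fin d) := e i
  have hφ (i) : φ i ∈ ME d := (e i).2
  have hpure (i) : IsPureState (φ i) := isPureState_of_mem_ME hd0.ne' (hφ i)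
  have hoverlap (p : {p : Fin n × Fin n // p.1 ≠ p.2}) : hsInner (φ p.1.1) (φ p.1.2) < 1 :=
    (hpure _).hsInner_lt_one (hpure _) fun h => p.2 (Fin.ext (e.injective (Subtype.ext h)))
  let δ := min (ε / d) 1
  have hδ : 0 < δ := by positivity
  have hδε : d * δ ≤ ε := (le_div_iff₀' (by positivity)).1 (min_le_left _ _)
  obtain ⟨t, ht1, htδ, ht⟩ := exists_gt_one_forall_mul_le_one hoverlap
    (lt_add_of_pos_right 1 (half_pos hδ))
  choose K hK hwK hφK using fun i => exists_isPSES_witness_mem hd hδ.le (min_le_right _ _) (hφ i)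
    (zero_le_one.trans ht1.le) htδ (S := φ '' {j | i ≠ j}) (Set.image_subset_iff.2 fun j _ => hφ j)
    (Set.forall_mem_image.2 fun j hj => ht ⟨(i, j), hj⟩)
  have hneg (i) : hsInner (φ i) (witness t (φ i)) < 0 := (hpure i).hsInner_witness_neg ht1
  refine ⟨K, fun i => ⟨(hK i).mono hδε, fun h => (hneg i).not_ge ?_⟩,
    isIndependentFamily_of_separating hwK (fun i j hij => ?_) hneg⟩
  · exact hsInner_nonneg_of_mem_psd (hpure i).mem_psd (h.subset (hwK i))
  · exact (hK j).selfDual.symm ▸ hφK j (Set.mem_image_of_mem φ hij)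

end Construction

end EntanglementStructure

theorem theorem3 (d : ℕ) (hd : 2 ≤ d) (ε : ℝ) (hε : 0 < ε) :
    {K : Set (EntanglementStructure.Herm (Fin d × Fin d)) |
        EntanglementStructure.IsPSES ε K ∧ K ≠ EntanglementStructure.SES d}.Infinite ∧
      ∀ n : ℕ, ∃ K : Fin n → Set (EntanglementStructure.Herm (Fin d × Fin d)),
        (∀ i, EntanglementStructure.IsPSES ε (K i) ∧ K i ≠ EntanglementStructure.SES d) ∧
        EntanglementStructure.IsIndependentFamily K := by
  have hfamily (n : ℕ) := EntanglementStructure.exists_isIndependentFamily_isPSES hd hε n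
  refine ⟨EntanglementStructure.infinite_of_forall_exists_isIndependentFamily ?_ hfamily, hfamily⟩
  exact fun K hK => hK.1.selfDual ▸ EntanglementStructure.zero_mem_dual K
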